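/- Let $M$ be a finite matroid of rank $r\ge 2$ with ground set $X$, and let $R\subseteq X$. For an integer $a$ with $0\le a\le r$, let $B(M,R,a)$ be the number of bases $A$ of $M$ with $|A\cap R|=a$, and put $P(M,R,a):=B(M,R,a)\binom{r}{a}^{-1}$. Suppose that $P(M,R,0)>0$ and $P(M,R,r)>0$. Then $$P(M,R,1)^r\ \ge\ P(M,R,0)^{r-1}\,P(M,R,r).$$ Moreover, equality holds here if and only if $$P(M,R,a)^2=P(M,R,a+1)\,P(M,R,a-1)\qquad\text{for all integers } 1\le a\le r-1.$$ -/

import Mathlib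

/-- The rank of a matroid as a natural number; for a finite matroid (the only case used)
this is the common cardinality of its bases. -/
noncomputable def matroidRank {α : Type*} (M : Matroid α) : ℕ :=
  M.eRank.toNat

/-- `B(M, R, a)`: the number of bases `A` of `M` with `|A ∩ R| = a`. -/
noncomputable def numBases {α : Type*} (M : Matroid α) (R : Set α) (a : ℕ) : ℕ :=
  {A : Set α | M.IsBase A ∧ (A ∩ R).ncard = a}.ncard

/-- `P(M, R, a) = B(M, R, a) / (r choose a)`, where `r` is the rank of `M`. -/
noncomputable def normalizedNumBases {α : Type*} (M : Matroid α) (R : Set α) (a : ℕ) : ℝ :=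
  (numBases M R a : ℝ) / ((matroidRank M).choose a : ℝ)

/-! The numbers P(M,R,a) are log-concave in a (the Stanley-Yan inequality). Two bases, one inside R
and one disjoint from R, force all of them to be positive. A positive log-concave sequence lies
below the geometric sequence with the same first two terms; at index r this is the inequality, and
equality there forces agreement throughout (`pow_ge_and_eq_iff_of_logConcave`).

Log-concavity is an Alexandrov-Fenchel inequality. `indepSum` is a symmetric multilinear form in the
weights; evaluated at a copies of the indicator of R and r-a copies of that of its complement it
gives r! P(M,R,a). That its quadratic specialisations are hyperbolic (`indepSum_mul_le_sq_of_pos`)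
follows by induction on the number of fixed weights. With none, the form is read off from parallel
classes. In the inductive step, the inequality for every `insert i I` sums to the hypothesis of the
Bochner criterion `dotProduct_mulVec_nonpos_of_bochner` for `I`. Nonnegative weights are then
reached by a limit. -/

open Finset Matrix

/-! ### Spectral theory: the Bochner criterion. -/

/-- The eigenbasis expansion of a real symmetric matrix, in coordinates. -/
theorem exists_eigenbasis_expansion {ι : Type*} [Fintype ι] (S : Matrix ι ι ℝ) (hS : S.IsSymm) :
    ∃ (l : ι → ℝ) (u : ι → ι → ℝ), (∀ k, S *ᵥ u k = l k • u k) ∧ (∀ k, u k ⬝ᵥ u k = 1) ∧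
      ∀ w, w ⬝ᵥ S *ᵥ w = ∑ k, l k * (u k ⬝ᵥ w) ^ 2 := by
  classical
  have hH : S.IsHermitian := by
    rw [Matrix.IsHermitian, Matrix.conjTranspose_eq_transpose_of_trivial, hS.eq]
  have hinner : ∀ v w : EuclideanSpace ℝ ι, inner ℝ v w = v.ofLp ⬝ᵥ w.ofLp := by
    intro v w
    simp [PiLp.inner_apply, dotProduct, mul_comm]
  have heig : ∀ k, S *ᵥ (hH.eigenvectorBasis k).ofLp
      = hH.eigenvalues k • (hH.eigenvectorBasis k).ofLp := fun k => by
    simpa using hH.mulVec_eigenvectorBasis k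
  refine ⟨hH.eigenvalues, fun k => (hH.eigenvectorBasis k).ofLp, heig, fun k => ?_, fun w => ?_⟩
  · rw [← hinner, real_inner_self_eq_norm_sq, hH.eigenvectorBasis.orthonormal.1 k]
    norm_num
  · have h := hH.eigenvectorBasis.sum_inner_mul_inner (WithLp.toLp 2 w) (WithLp.toLp 2 (S *ᵥ w))
    rw [hinner] at h
    change _ = w ⬝ᵥ S *ᵥ w at h
    rw [← h]
    refine Finset.sum_congr rfl fun k _ => ?_
    rw [hinner, hinner]
    have h2 : (hH.eigenvectorBasis k).ofLp ⬝ᵥ S *ᵥ w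
        = hH.eigenvalues k * ((hH.eigenvectorBasis k).ofLp ⬝ᵥ w) := by
      rw [dotProduct_mulVec, ← mulVec_transpose, hS.eq, heig, smul_dotProduct, smul_eq_mul]
    change (w ⬝ᵥ (hH.eigenvectorBasis k).ofLp) *
      ((hH.eigenvectorBasis k).ofLp ⬝ᵥ S *ᵥ w) = _
    rw [h2, dotProduct_comm w]
    ring

/-- The ground state identity for a nonnegative symmetric matrix: if `A y = l d y` with
`d = A c / c` and `1 ≤ l`, then `y / c` is constant along the edges of the support of `A`. -/
theorem div_eq_div_of_mulVec_eq {ι : Type*} [Fintype ι] {A : Matrix ι ι ℝ} (hA : A.IsSymm)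
    (h0 : ∀ i j, 0 ≤ A i j) {c : ι → ℝ} (hc : ∀ i, 0 < c i) (hAc : ∀ i, 0 < (A *ᵥ c) i)
    {l : ℝ} (hl : 1 ≤ l) {y : ι → ℝ} (hy : ∀ i, (A *ᵥ y) i = l * ((A *ᵥ c) i / c i) * y i)
    {i j : ι} (hij : 0 < A i j) : y i / c i = y j / c j := by
  -- Expand the square: since `A` is symmetric, both pure square terms reduce to row sums of `A *ᵥ
  -- c`, and the cross term is given by the equation for `y`.
  have hsum : ∑ i, ∑ j, A i j * c i * c j * (y i / c i - y j / c j) ^ 2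
      = 2 * ((1 - l) * ∑ i, (A *ᵥ c) i / c i * y i ^ 2) := by
    have h1 : ∀ i j, A i j * c i * c j * (y i / c i - y j / c j) ^ 2
        = y i ^ 2 / c i * (A i j * c j) + y j ^ 2 / c j * (A j i * c i)
          - 2 * (y i * (A i j * y j)) := by
      intro i j
      rw [hA.apply i j]
      have := (hc i).ne'
      have := (hc j).ne'
      field_simp
      ring
    have h2 : ∑ i, ∑ j, y i ^ 2 / c i * (A i j * c j) = ∑ i, (A *ᵥ c) i / c i * y i ^ 2 := by
      refine sum_congr rfl fun i _ => ?_
      rw [← mul_sum]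
      change _ * (A *ᵥ c) i = _
      ring
    have h3 : ∑ i, ∑ j, y i * (A i j * y j) = l * ∑ i, (A *ᵥ c) i / c i * y i ^ 2 := by
      rw [mul_sum]
      refine sum_congr rfl fun i _ => ?_
      rw [← mul_sum]
      change _ * (A *ᵥ y) i = _
      rw [hy]
      ring
    simp_rw [h1, sum_sub_distrib, sum_add_distrib]
    rw [sum_comm (f := fun i j => y j ^ 2 / c j * (A j i * c i)), h2]
    simp_rw [← mul_sum] at h3 ⊢
    rw [h3]
    ring
  have hterm : ∀ i j, 0 ≤ A i j * c i * c j * (y i / c i - y j / c j) ^ 2 := fun i j =>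
    mul_nonneg (mul_nonneg (mul_nonneg (h0 i j) (hc i).le) (hc j).le) (sq_nonneg _)
  have hle : ∑ i, ∑ j, A i j * c i * c j * (y i / c i - y j / c j) ^ 2 ≤ 0 := by
    rw [hsum]
    have : 0 ≤ ∑ i, (A *ᵥ c) i / c i * y i ^ 2 :=
      sum_nonneg fun i _ => mul_nonneg (div_pos (hAc i) (hc i)).le (sq_nonneg _)
    nlinarith
  have hz : A i j * c i * c j * (y i / c i - y j / c j) ^ 2 ≤ 0 :=
    ((single_le_sum (fun j _ => hterm i j) (mem_univ j)).trans
      (single_le_sum (f := fun i => ∑ j, A i j * c i * c j * (y i / c i - y j / c j) ^ 2)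
        (fun i _ => sum_nonneg fun j _ => hterm i j) (mem_univ i))).trans hle
  have hpos : 0 < A i j * c i * c j := mul_pos (mul_pos hij (hc i)) (hc j)
  have : (y i / c i - y j / c j) ^ 2 = 0 := by
    nlinarith [sq_nonneg (y i / c i - y j / c j)]
  exact sub_eq_zero.mp (pow_eq_zero_iff two_ne_zero |>.mp this)

/-- The Bochner method: a connected nonnegative symmetric matrix satisfying the given
quadratic inequality is negative semidefinite on the orthogonal complement of `A c`. -/
theorem dotProduct_mulVec_nonpos_of_bochner {ι : Type*} [Fintype ι] {A : Matrix ι ι ℝ}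
    (hA : A.IsSymm) (h0 : ∀ i j, 0 ≤ A i j) {c : ι → ℝ} (hc : ∀ i, 0 < c i)
    (hAc : ∀ i, 0 < (A *ᵥ c) i)
    (hconn : ∀ v : ι → ℝ, (∀ i j, 0 < A i j → v i = v j) → ∀ i j, v i = v j)
    (hB : ∀ x, x ⬝ᵥ A *ᵥ x ≤ ∑ i, c i * ((A *ᵥ x) i ^ 2 / (A *ᵥ c) i))
    {x : ι → ℝ} (hx : c ⬝ᵥ A *ᵥ x = 0) : x ⬝ᵥ A *ᵥ x ≤ 0 := by
  -- With D the diagonal matrix of `d`, D⁻¹A is self-adjoint for the `d`-weighted inner product and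
  -- fixes `c`. Conjugating by √D makes it the symmetric matrix `S`.
  set d : ι → ℝ := fun i => (A *ᵥ c) i / c i with hd
  have hdpos : ∀ i, 0 < d i := fun i => div_pos (hAc i) (hc i)
  set s : ι → ℝ := fun i => √(d i) with hs
  have hspos : ∀ i, 0 < s i := fun i => Real.sqrt_pos.mpr (hdpos i)
  have hss : ∀ i, s i * s i = d i := fun i => Real.mul_self_sqrt (hdpos i).le
  set S : Matrix ι ι ℝ := fun i j => A i j / (s i * s j) with hSdef
  have hS : S.IsSymm := by
    ext i j
    change A j i / (s j * s i) = A i j / (s i * s j)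
    rw [hA.apply, mul_comm]
  have hmul : ∀ (w : ι → ℝ) i, (A *ᵥ w) i = s i * (S *ᵥ fun j => s j * w j) i := by
    intro w i
    simp only [mulVec, dotProduct, hSdef, mul_sum]
    refine sum_congr rfl fun j _ => ?_
    have := (hspos i).ne'
    have := (hspos j).ne'
    field_simp
  obtain ⟨l, u, hu, hu1, hexp⟩ := exists_eigenbasis_expansion S hS
  have hq : x ⬝ᵥ A *ᵥ x = (fun j => s j * x j) ⬝ᵥ S *ᵥ fun j => s j * x j := by
    simp only [dotProduct, hmul x]
    exact sum_congr rfl fun i _ => by ring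
  rw [hq, hexp]
  refine sum_nonpos fun k _ => ?_
  rcases le_or_gt (l k) 0 with hlk | hlk
  · exact mul_nonpos_of_nonpos_of_nonneg hlk (sq_nonneg _)
  set y : ι → ℝ := fun i => u k i / s i with hy
  have hsy : (fun j => s j * y j) = u k := by
    ext j
    have := (hspos j).ne'
    simp only [hy]
    field_simp
  have hAy : ∀ i, (A *ᵥ y) i = l k * d i * y i := by
    intro i
    rw [hmul, hsy, hu, ← hss, Pi.smul_apply, smul_eq_mul, ← congr_fun hsy i]
    ring
  have hnorm : ∑ i, d i * y i ^ 2 = 1 := by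
    rw [← hu1 k, ← hsy]
    refine sum_congr rfl fun i _ => ?_
    rw [← hss]
    ring
  -- Testing `hB` on the eigenvector `y` gives l ≤ l², so no eigenvalue lies strictly between 0 and
  -- 1.
  have hl1 : 1 ≤ l k := by
    have h1 : y ⬝ᵥ A *ᵥ y = l k := by
      rw [← mul_one (l k), ← hnorm, mul_sum]
      exact sum_congr rfl fun i _ => by rw [hAy]; ring
    have h2 : ∑ i, c i * ((A *ᵥ y) i ^ 2 / (A *ᵥ c) i) = l k ^ 2 := by
      rw [← mul_one (l k ^ 2), ← hnorm, mul_sum]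
      refine sum_congr rfl fun i _ => ?_
      have e : (A *ᵥ c) i = d i * c i := by simp [hd, (hc i).ne']
      have := (hc i).ne'
      have := (hdpos i).ne'
      rw [hAy, e]
      field_simp
    have h3 := hB y
    rw [h1, h2] at h3
    nlinarith
  have hconst := hconn (fun i => y i / c i) fun i j hij =>
    div_eq_div_of_mulVec_eq hA h0 hc hAc hl1 hAy hij
  -- Eigenvectors with eigenvalue at least 1 are multiples of `c`, so `x` has no component along
  -- them.
  have horth : y ⬝ᵥ A *ᵥ x = 0 := by
    rcases isEmpty_or_nonempty ι with h | ⟨⟨i₀⟩⟩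
    · simp [dotProduct]
    have hyc : y = (y i₀ / c i₀) • c := by
      ext i
      rw [Pi.smul_apply, smul_eq_mul, ← hconst i i₀, div_mul_cancel₀ _ (hc i).ne']
    rw [hyc, smul_dotProduct, hx, smul_zero]
  have : l k * (u k ⬝ᵥ fun j => s j * x j) = 0 := by
    rw [← horth, dotProduct_mulVec, ← mulVec_transpose, hA.eq, ← hsy]
    simp only [dotProduct, mul_sum]
    refine sum_congr rfl fun i _ => ?_
    rw [hAy, ← hss]
    ring
  rcases mul_eq_zero.mp this with h | h
  · exact absurd h hlk.ne'
  · rw [h]; simp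

/-! ### Binary quadratic forms and log-concave sequences. -/

/-- A binary quadratic form that is nonpositive on a line satisfies the reverse Cauchy-Schwarz
inequality. -/
theorem mul_le_sq_of_nonpos_on_line {a b d l m : ℝ}
    (h : ∀ s t : ℝ, s * l + t * m = 0 → s ^ 2 * a + 2 * s * t * b + t ^ 2 * d ≤ 0)
    (hd : 0 ≤ d) : a * d ≤ b ^ 2 := by
  by_contra! hlt
  have ha : 0 < a := by
    by_contra! ha
    nlinarith [sq_nonneg b]
  have h1 := h m (-l) (by ring)
  -- This is `h1` multiplied by `a`, with the square completed.
  have h2 : (m * a - l * b) ^ 2 + l ^ 2 * (a * d - b ^ 2) ≤ 0 := by nlinarith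
  have h3 : 0 ≤ l ^ 2 * (a * d - b ^ 2) := mul_nonneg (sq_nonneg _) (by linarith)
  have hl : l = 0 := by
    have : l ^ 2 * (a * d - b ^ 2) = 0 := by nlinarith [sq_nonneg (m * a - l * b)]
    rcases mul_eq_zero.mp this with h | h
    · simpa using h
    · linarith
  have := h 1 0 (by simp [hl])
  linarith

/-- If `p` is positive and log-concave on `0, …, r`, then `p 1 ^ r ≥ p 0 ^ (r - 1) * p r`, with
equality exactly when `p` is geometric. -/
theorem pow_ge_and_eq_iff_of_logConcave {p : ℕ → ℝ} {r : ℕ} (hr : 2 ≤ r)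
    (hpos : ∀ a ≤ r, 0 < p a)
    (hlc : ∀ a, 1 ≤ a → a ≤ r - 1 → p (a + 1) * p (a - 1) ≤ p a ^ 2) :
    p 1 ^ r ≥ p 0 ^ (r - 1) * p r ∧
    (p 1 ^ r = p 0 ^ (r - 1) * p r ↔
      ∀ a : ℕ, 1 ≤ a → a ≤ r - 1 → p a ^ 2 = p (a + 1) * p (a - 1)) := by
  have h0 := hpos 0 (by omega)
  have h1 := hpos 1 (by omega)
  have hstep : ∀ k, k + 1 ≤ r → p (k + 1) * p 0 ≤ p k * p 1 := by
    intro k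
    induction k with
    | zero => intro _; linarith [mul_comm (p 1) (p 0)]
    | succ k ih =>
      intro hk
      have i1 := ih (by omega)
      have i2 := hlc (k + 1) (by omega) (by omega)
      rw [Nat.add_sub_cancel] at i2
      have hk0 := hpos k (by omega)
      have hk1 := hpos (k + 1) (by omega)
      refine le_of_mul_le_mul_right ?_ hk0
      nlinarith
  have hρ : 0 < p 1 / p 0 := div_pos h1 h0
  -- Divide `p` by the geometric sequence with the same first two terms. Then `q` starts 1, 1 and is
  -- nonincreasing, so `q r = 1` only if `q` is constantly 1.
  set q : ℕ → ℝ := fun k => p k / (p 0 * (p 1 / p 0) ^ k) with hq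
  have hp : ∀ k, p k = q k * (p 0 * (p 1 / p 0) ^ k) := fun k => by
    simp only [hq]
    rw [div_mul_cancel₀ _ (by positivity)]
  have hq0 : q 0 = 1 := by simp [hq, h0.ne']
  have hq1 : q 1 = 1 := by
    simp only [hq, pow_one]
    rw [mul_div_cancel₀ _ h0.ne', div_self h1.ne']
  have hqstep : ∀ k, k + 1 ≤ r → q (k + 1) ≤ q k := by
    intro k hk
    have h := hstep k hk
    have e : p 1 = p 0 * (p 1 / p 0) := (mul_div_cancel₀ _ h0.ne').symm
    rw [hp (k + 1), hp k] at h
    have hw : 0 < p 0 * (p 1 / p 0) ^ (k + 1) * p 0 := by positivity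
    refine le_of_mul_le_mul_right ?_ hw
    calc _ = _ := by ring
      _ ≤ _ := h
      _ = _ := by rw [pow_succ]; linear_combination (q k * p 0 * (p 1 / p 0) ^ k) * e
  have hanti : ∀ k m, k + m ≤ r → q (k + m) ≤ q k := by
    intro k m
    induction m with
    | zero => intro _; rfl
    | succ m ih => intro h; exact (hqstep (k + m) h).trans (ih (by omega))
  have hrw : p 0 ^ (r - 1) * p r = q r * p 1 ^ r := by
    obtain ⟨m, rfl⟩ : ∃ m, r = m + 1 := ⟨r - 1, by omega⟩
    rw [hp (m + 1), Nat.add_sub_cancel, div_pow]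
    field_simp
    ring
  have hp1 : 0 < p 1 ^ r := pow_pos h1 r
  have hqr : q r ≤ 1 := by
    have := hanti 0 r (by omega)
    rwa [zero_add, hq0] at this
  have hiff : ∀ a, 1 ≤ a →
      (p a ^ 2 = p (a + 1) * p (a - 1) ↔ q a ^ 2 = q (a + 1) * q (a - 1)) := by
    intro a ha
    obtain ⟨b, rfl⟩ : ∃ b, a = b + 1 := ⟨a - 1, by omega⟩
    rw [Nat.add_sub_cancel, hp (b + 1), hp (b + 1 + 1), hp b]
    have hw : (p 0 * (p 1 / p 0) ^ (b + 1)) ^ 2 ≠ 0 := by positivity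
    rw [← mul_left_inj' hw (a := q (b + 1) ^ 2)]
    constructor <;> intro h
    · linear_combination h
    · linear_combination h
  rw [hrw]
  refine ⟨by nlinarith, ?_⟩
  constructor
  · intro h a ha har
    have hqr1 : q r = 1 := by
      rw [eq_comm, mul_eq_right₀ hp1.ne'] at h
      exact h
    have hone : ∀ k ≤ r, q k = 1 := by
      intro k hk
      refine le_antisymm ?_ ?_
      · have := hanti 0 k (by omega)
        rwa [zero_add, hq0] at this
      · have := hanti k (r - k) (by omega)
        rwa [Nat.add_sub_cancel' hk, hqr1] at this
    rw [hiff a ha, hone a (by omega), hone (a + 1) (by omega), hone (a - 1) (by omega)]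
    norm_num
  · intro h
    have hone : ∀ k, k + 1 ≤ r → q k = 1 ∧ q (k + 1) = 1 := by
      intro k
      induction k with
      | zero => intro _; exact ⟨hq0, hq1⟩
      | succ k ih =>
        intro hk
        obtain ⟨i1, i2⟩ := ih (by omega)
        have := (hiff (k + 1) (by omega)).mp (h (k + 1) (by omega) (by omega))
        rw [Nat.add_sub_cancel, i1, i2] at this
        exact ⟨i2, by linarith⟩
    have := (hone (r - 1) (by omega)).2
    rw [Nat.sub_add_cancel (by omega)] at this
    rw [this, one_mul]

/-! ### Independent extensions and their weighted sums. -/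

open Classical in
/-- The elements by which the independent set `I` can be extended. -/
noncomputable def extensions {α : Type*} (M : Matroid α) [M.Finite] (I : Finset α) : Finset α :=
  M.ground_finite.toFinset.filter fun e => e ∉ I ∧ M.Indep (insert e I : Set α)

open Classical in
/-- The weighted count of the sequences that extend `I` independently: `indepSum M [c₁, …, cₖ] I`
is the sum of `c₁ e₁ ⋯ cₖ eₖ` over all sequences of distinct `e₁, …, eₖ ∉ I` with
`I ∪ {e₁, …, eₖ}` independent. -/
noncomputable def indepSum {α : Type*} (M : Matroid α) [M.Finite] :
    List (α → ℝ) → Finset α → ℝ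
  | [], _ => 1
  | c :: cs, I => ∑ e ∈ extensions M I, c e * indepSum M cs (insert e I)

theorem card_eq_of_isBase {α : Type*} {M : Matroid α} {B : Finset α}
    (hB : M.IsBase B) : B.card = matroidRank M := by
  rw [matroidRank, ← hB.encard_eq_eRank, Set.encard_coe_eq_coe_finsetCard, ENat.toNat_natCast]

section

variable {α : Type*} {M : Matroid α} [M.Finite] {I : Finset α} {i j k : α}

theorem mem_extensions : i ∈ extensions M I ↔ i ∉ I ∧ M.Indep (insert i I : Set α) := by
  simp only [extensions, mem_filter, Set.Finite.mem_toFinset, and_iff_right_iff_imp]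
  exact fun h => h.2.subset_ground (Set.mem_insert _ _)

open Classical in
theorem mem_extensions_insert :
    j ∈ extensions M (insert i I) ↔ j ≠ i ∧ j ∉ I ∧ M.Indep (insert j (insert i I) : Set α) := by
  rw [mem_extensions, mem_insert, coe_insert]
  tauto

open Classical in
theorem mem_extensions_insert_comm : i ∈ extensions M I ∧ j ∈ extensions M (insert i I) ↔
    i ∈ extensions M (insert j I) ∧ j ∈ extensions M I := by
  rw [mem_extensions_insert, mem_extensions_insert, mem_extensions, mem_extensions]
  constructor
  · rintro ⟨⟨h1, h2⟩, h3, h4, h5⟩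
    exact ⟨⟨h3.symm, h1, by rwa [Set.insert_comm]⟩, h4, h5.subset
      (Set.insert_subset_insert (Set.subset_insert _ _))⟩
  · rintro ⟨⟨h1, h2, h3⟩, h4, h5⟩
    exact ⟨⟨h2, h3.subset (Set.insert_subset_insert (Set.subset_insert _ _))⟩, h1.symm, h4,
      by rwa [Set.insert_comm]⟩

open Classical in
theorem mem_extensions_of_insert (h : j ∈ extensions M (insert i I)) : j ∈ extensions M I := by
  rw [mem_extensions_insert] at h
  rw [mem_extensions]
  refine ⟨h.2.1, h.2.2.subset (Set.insert_subset_insert (Set.subset_insert _ _))⟩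

-- Augment I ∪ {j} from the larger independent set I ∪ {i, k}: the new element cannot be i, because
-- i and j are parallel over I, so it is k.
open Classical in
theorem extensions_insert_subset (hi : i ∈ extensions M I) (hj : j ∈ extensions M I)
    (hij : j ∉ extensions M (insert i I)) :
    extensions M (insert i I) ⊆ extensions M (insert j I) := by
  intro k hk
  have hk' := hk
  rw [mem_extensions_insert] at hk
  rw [mem_extensions] at hi hj
  have hI : M.Indep (insert j I : Finset α) := by simpa using hj.2
  have hJ : M.Indep (insert k (insert i I) : Finset α) := by simpa using hk.2.2
  obtain ⟨e, he, heI, hind⟩ := hI.augment_finset hJ (by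
    rw [card_insert_of_notMem hj.1, card_insert_of_notMem (by simp [hk.1, hk.2.1]),
      card_insert_of_notMem hi.1]
    omega)
  simp only [mem_insert, not_or, coe_insert] at he heI hind
  rcases he with rfl | rfl | he
  · exact mem_extensions_insert.mpr ⟨heI.1, heI.2, by simpa using hind⟩
  · refine absurd ?_ hij
    rw [mem_extensions_insert, Set.insert_comm]
    exact ⟨Ne.symm heI.1, hj.1, by simpa using hind⟩
  · exact absurd he heI.2

open Classical in
/-- Two extensions of `I` are parallel over `I` exactly when they have the same further
extensions. -/
theorem mem_extensions_insert_iff (hi : i ∈ extensions M I) (hj : j ∈ extensions M I) :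
    j ∈ extensions M (insert i I) ↔
      extensions M (insert j I) ≠ extensions M (insert i I) := by
  constructor
  · intro h he
    rw [← he, mem_extensions_insert] at h
    exact h.1 rfl
  · intro h
    by_contra hij
    refine h (subset_antisymm ?_ ?_)
    · refine extensions_insert_subset hj hi fun h' => hij ?_
      exact (mem_extensions_insert_comm.mpr ⟨h', hj⟩).2
    · exact extensions_insert_subset hi hj hij

theorem exists_isBase_finset (M : Matroid α) [M.Finite] : ∃ B : Finset α, M.IsBase B := by
  obtain ⟨B, hB⟩ := M.exists_isBase
  lift B to Finset α using M.ground_finite.subset hB.subset_ground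
  exact ⟨B, hB⟩

theorem extensions_nonempty (hI : M.Indep I) (hr : I.card < matroidRank M) :
    (extensions M I).Nonempty := by
  obtain ⟨B, hB⟩ := exists_isBase_finset M
  rw [← card_eq_of_isBase hB] at hr
  obtain ⟨e, -, he, h⟩ := hI.augment_finset hB.indep hr
  exact ⟨e, mem_extensions.mpr ⟨he, by simpa using h⟩⟩

open Classical in
theorem indep_insert (hi : i ∈ extensions M I) : M.Indep (insert i I : Finset α) := by
  simpa using (mem_extensions.mp hi).2

open Classical in
theorem card_insert_extension (hi : i ∈ extensions M I) : (insert i I).card = I.card + 1 :=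
  card_insert_of_notMem (mem_extensions.mp hi).1

theorem indepSum_nil (I : Finset α) : indepSum M [] I = 1 := rfl

open Classical in
theorem indepSum_cons (c : α → ℝ) (cs : List (α → ℝ)) (I : Finset α) :
    indepSum M (c :: cs) I = ∑ e ∈ extensions M I, c e * indepSum M cs (insert e I) := rfl

open Classical in
theorem indepSum_cons_cons (x y : α → ℝ) (cs : List (α → ℝ)) (I : Finset α) :
    indepSum M (x :: y :: cs) I = ∑ i ∈ extensions M I, ∑ j ∈ extensions M (insert i I),
      x i * y j * indepSum M cs (insert j (insert i I)) := by
  simp_rw [indepSum_cons, mul_sum, mul_assoc]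

theorem indepSum_swap (x y : α → ℝ) (cs : List (α → ℝ)) (I : Finset α) :
    indepSum M (x :: y :: cs) I = indepSum M (y :: x :: cs) I := by
  classical
  rw [indepSum_cons_cons, indepSum_cons_cons, sum_comm' fun i j => mem_extensions_insert_comm]
  refine sum_congr rfl fun i _ => sum_congr rfl fun j _ => ?_
  rw [Finset.insert_comm, mul_comm (x j)]

theorem indepSum_perm {cs ds : List (α → ℝ)} (h : cs.Perm ds) (I : Finset α) :
    indepSum M cs I = indepSum M ds I := by
  classical
  induction h generalizing I with
  | nil => rfl
  | cons c _ ih => simp_rw [indepSum_cons, ih]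
  | swap x y cs => exact indepSum_swap _ _ _ _
  | trans _ _ ih1 ih2 => rw [ih1, ih2]

theorem indepSum_nonneg {cs : List (α → ℝ)} (hcs : ∀ c ∈ cs, ∀ e, 0 ≤ c e) (I : Finset α) :
    0 ≤ indepSum M cs I := by
  classical
  induction cs generalizing I with
  | nil => exact zero_le_one
  | cons c cs ih =>
    rw [indepSum_cons]
    simp only [List.mem_cons, forall_eq_or_imp] at hcs
    exact sum_nonneg fun e _ => mul_nonneg (hcs.1 e) (ih hcs.2 _)

theorem indepSum_pos {cs : List (α → ℝ)} (hcs : ∀ c ∈ cs, ∀ e, 0 < c e) (hI : M.Indep I)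
    (hr : I.card + cs.length ≤ matroidRank M) : 0 < indepSum M cs I := by
  classical
  induction cs generalizing I with
  | nil => exact zero_lt_one
  | cons c cs ih =>
    rw [indepSum_cons]
    simp only [List.mem_cons, forall_eq_or_imp, List.length_cons] at hcs hr
    refine sum_pos (fun e he => mul_pos (hcs.1 e) (ih hcs.2 (indep_insert he) ?_))
      (extensions_nonempty hI (by omega))
    rw [card_insert_extension he]
    omega

theorem indepSum_linear (s t : ℝ) (x y : α → ℝ) (cs : List (α → ℝ)) (I : Finset α) :
    indepSum M ((s • x + t • y) :: cs) I
      = s * indepSum M (x :: cs) I + t * indepSum M (y :: cs) I := by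
  classical
  simp only [indepSum_cons, mul_sum, ← sum_add_distrib, Pi.add_apply, Pi.smul_apply, smul_eq_mul]
  exact sum_congr rfl fun i _ => by ring

theorem indepSum_quadratic (s t : ℝ) (x y : α → ℝ) (cs : List (α → ℝ)) (I : Finset α) :
    indepSum M ((s • x + t • y) :: (s • x + t • y) :: cs) I
      = s ^ 2 * indepSum M (x :: x :: cs) I + 2 * s * t * indepSum M (x :: y :: cs) I
        + t ^ 2 * indepSum M (y :: y :: cs) I := by
  rw [indepSum_linear, indepSum_swap x, indepSum_swap y, indepSum_linear, indepSum_linear,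
    indepSum_swap y x]
  ring

/-- If the quadratic form `x ↦ indepSum M (x :: x :: cs) I` is nonpositive on the kernel of a
linear form, then it satisfies the reverse Cauchy-Schwarz inequality. -/
theorem indepSum_mul_le_sq_of_nonpos {cs : List (α → ℝ)} (l : (α → ℝ) → ℝ)
    (hl : ∀ (s t : ℝ) x y, l (s • x + t • y) = s * l x + t * l y)
    (h : ∀ x, l x = 0 → indepSum M (x :: x :: cs) I ≤ 0)
    (x y : α → ℝ) (hy : 0 ≤ indepSum M (y :: y :: cs) I) :
    indepSum M (x :: x :: cs) I * indepSum M (y :: y :: cs) I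
      ≤ indepSum M (x :: y :: cs) I ^ 2 := by
  refine mul_le_sq_of_nonpos_on_line (l := l x) (m := l y) (fun s t hst => ?_) hy
  rw [← indepSum_quadratic]
  exact h _ (by rw [hl, hst])

/-- Ordered pairs that extend `I` are all pairs minus those within one parallel class. If `x` has
total zero, what remains is minus the sum of the squares of its class totals. -/
theorem indepSum_pair_nonpos (x : α → ℝ) (hx : ∑ i ∈ extensions M I, x i = 0) :
    indepSum M [x, x] I ≤ 0 := by
  classical
  set N := extensions M I with hN
  set f : α → Finset α := fun i => extensions M (insert i I) with hf
  have h1 : indepSum M [x, x] I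
      = ∑ i ∈ N, x i * ∑ j ∈ N, x j - ∑ i ∈ N, x i * ∑ j ∈ N with f j = f i, x j := by
    rw [indepSum_cons_cons, ← sum_sub_distrib]
    refine sum_congr rfl fun i hi => ?_
    simp_rw [indepSum_nil, mul_one, ← mul_sum, ← mul_sub]
    rw [← sum_filter_not_add_sum_filter N (fun j => f j = f i), add_sub_cancel_right]
    congr 1
    refine sum_congr ?_ fun _ _ => rfl
    ext j
    rw [mem_filter]
    constructor
    · intro h
      have hj := mem_extensions_of_insert h
      exact ⟨hj, (mem_extensions_insert_iff hi hj).mp h⟩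
    · rintro ⟨hj, h⟩
      exact (mem_extensions_insert_iff hi hj).mpr h
  have h2 : ∑ i ∈ N, x i * ∑ j ∈ N with f j = f i, x j
      = ∑ t ∈ N.image f, (∑ i ∈ N with f i = t, x i) ^ 2 := by
    rw [← sum_fiberwise_of_maps_to (g := f) fun i hi => mem_image_of_mem f hi]
    refine sum_congr rfl fun t _ => ?_
    rw [sq, sum_mul]
    refine sum_congr rfl fun i hi => ?_
    rw [(mem_filter.mp hi).2]
  rw [h1, hx, h2]
  simp only [mul_zero, sum_const_zero, zero_sub, Left.neg_nonpos_iff]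
  exact sum_nonneg fun _ _ => sq_nonneg _

/-- Two extensions of `I` are joined by a path of nonparallel elements when the rank allows two
more elements. -/
theorem eq_of_forall_mem_extensions_insert (hr : I.card + 2 ≤ matroidRank M)
    {β : Type*} (v : extensions M I → β)
    (hv : ∀ i j : extensions M I, open Classical in j.1 ∈ extensions M (insert i.1 I) → v i = v j)
    (i j : extensions M I) : v i = v j := by
  classical
  by_cases hij : j.1 ∈ extensions M (insert i.1 I)
  · exact hv i j (by convert hij)
  obtain ⟨k, hk⟩ := extensions_nonempty (indep_insert i.2) (by
    rw [card_insert_extension i.2]; omega)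
  have hkI := mem_extensions_of_insert hk
  have hkj := extensions_insert_subset i.2 j.2 hij hk
  exact (hv i ⟨k, hkI⟩ (by convert hk)).trans (hv j ⟨k, hkI⟩ (by convert hkj)).symm

end

/-! ### The Alexandrov-Fenchel inequality. -/

section

variable {α : Type*} {M : Matroid α} [M.Finite] {I : Finset α}

open Classical in
/-- The matrix of the bilinear form `(x, y) ↦ indepSum M (x :: y :: cs) I`. -/
noncomputable def indepMatrix (M : Matroid α) [M.Finite] (cs : List (α → ℝ)) (I : Finset α) :
    Matrix (extensions M I) (extensions M I) ℝ :=
  fun i j => if j.1 ∈ extensions M (insert i.1 I) then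
    indepSum M cs (insert j.1 (insert i.1 I)) else 0

theorem indepMatrix_isSymm (cs : List (α → ℝ)) : (indepMatrix M cs I).IsSymm := by
  classical
  ext i j
  have h : i.1 ∈ extensions M (insert j.1 I) ↔ j.1 ∈ extensions M (insert i.1 I) := by
    have := mem_extensions_insert_comm (M := M) (I := I) (i := i.1) (j := j.1)
    simpa [i.2, j.2, iff_comm] using this
  simp only [transpose_apply, indepMatrix, h, Finset.insert_comm i.1]

open Classical in
theorem indepMatrix_mulVec (cs : List (α → ℝ)) (x : α → ℝ) (i : extensions M I) :
    (indepMatrix M cs I *ᵥ fun j => x j) i = indepSum M (x :: cs) (insert i.1 I) := by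
  simp only [mulVec, dotProduct, indepMatrix, ite_mul, zero_mul]
  rw [sum_coe_sort (extensions M I) fun j => if j ∈ extensions M (insert i.1 I) then
    indepSum M cs (insert j (insert i.1 I)) * x j else 0, ← sum_filter, indepSum_cons]
  refine sum_congr ?_ fun j _ => mul_comm _ _
  ext j
  rw [mem_filter]
  exact ⟨And.right, fun h => ⟨mem_extensions_of_insert h, h⟩⟩

theorem dotProduct_indepMatrix_mulVec (cs : List (α → ℝ)) (x y : α → ℝ) :
    (fun i : extensions M I => x i) ⬝ᵥ (indepMatrix M cs I *ᵥ fun j => y j)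
      = indepSum M (x :: y :: cs) I := by
  classical
  simp only [dotProduct, indepMatrix_mulVec]
  rw [sum_coe_sort (extensions M I) fun i => x i * indepSum M (y :: cs) (insert i I)]
  rfl

/-- The form `(x, y) ↦ indepSum M (x :: y :: cs) I` is hyperbolic for positive `cs`. -/
theorem indepSum_mul_le_sq_of_pos {cs : List (α → ℝ)} (hcs : ∀ c ∈ cs, ∀ e, 0 < c e)
    (hI : M.Indep I) (hr : I.card + cs.length + 2 ≤ matroidRank M) (x y : α → ℝ)
    (hy : 0 ≤ indepSum M (y :: y :: cs) I) :
    indepSum M (x :: x :: cs) I * indepSum M (y :: y :: cs) I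
      ≤ indepSum M (x :: y :: cs) I ^ 2 := by
  classical
  induction cs generalizing I x y with
  | nil =>
    refine indepSum_mul_le_sq_of_nonpos (fun x => ∑ i ∈ extensions M I, x i) (fun s t x y => ?_)
      indepSum_pair_nonpos x y hy
    simp [sum_add_distrib, mul_sum]
  | cons c cs ih =>
    have hc := hcs c List.mem_cons_self
    rw [List.length_cons] at hr
    have hcard : ∀ i ∈ extensions M I, (insert i I).card = I.card + 1 :=
      fun i hi => card_insert_extension hi
    have hpos : ∀ i ∈ extensions M I, 0 < indepSum M (c :: c :: cs) (insert i I) := by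
      intro i hi
      refine indepSum_pos (by simpa using hcs) (indep_insert hi) ?_
      simp only [hcard i hi, List.length_cons]
      omega
    -- The linear form is pairing with A c, where A is `indepMatrix M (c :: cs) I`.
    refine indepSum_mul_le_sq_of_nonpos (fun x => indepSum M (c :: x :: c :: cs) I)
      (fun s t x y => ?_) (fun x hx => ?_) x y hy
    · rw [indepSum_swap, indepSum_linear, indepSum_swap x, indepSum_swap y]
    rw [← dotProduct_indepMatrix_mulVec] at hx ⊢
    refine dotProduct_mulVec_nonpos_of_bochner (c := fun i => c i) (indepMatrix_isSymm _)
      (fun i j => ?_) (fun i => hc i) (fun i => ?_) (fun v hv => ?_) (fun z => ?_) hx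
    · unfold indepMatrix
      split_ifs
      · exact indepSum_nonneg (fun c hc e => (hcs c hc e).le) _
      · exact le_rfl
    · rw [indepMatrix_mulVec]
      exact hpos i i.2
    · refine eq_of_forall_mem_extensions_insert (by omega) v fun i j hij => hv i j ?_
      rw [indepMatrix, if_pos (by convert hij)]
      refine indepSum_pos hcs (indep_insert (by convert hij)) ?_
      rw [card_insert_extension (by convert hij), hcard i i.2, List.length_cons]
      omega
    -- Moving `c` to the front writes the form as a `c`-weighted sum over `i` of forms at `insert i
    -- I`; the inductive hypothesis with second argument `c` bounds each term.
    · obtain ⟨w, rfl⟩ : ∃ w : α → ℝ, z = fun i : extensions M I => w i :=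
        ⟨fun a => if h : a ∈ extensions M I then z ⟨a, h⟩ else 0, by ext i; simp⟩
      simp only [indepMatrix_mulVec]
      rw [dotProduct_indepMatrix_mulVec,
        sum_coe_sort (extensions M I) fun i => c i * (indepSum M (w :: c :: cs) (insert i I) ^ 2 /
          indepSum M (c :: c :: cs) (insert i I)),
        indepSum_perm (ds := c :: w :: w :: cs) (by
          exact ((List.Perm.swap c w cs).cons w).trans (List.Perm.swap c w (w :: cs))),
        indepSum_cons]
      refine sum_le_sum fun i hi => mul_le_mul_of_nonneg_left ?_ (hc i).le
      rw [le_div_iff₀ (hpos i hi)]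
      refine ih (fun c hc => hcs c (List.mem_cons_of_mem _ hc)) (indep_insert hi) ?_ w c
        (hpos i hi).le
      rw [hcard i hi]
      omega

theorem continuous_indepSum_map_add (cs : List (α → ℝ)) (I : Finset α) :
    Continuous fun ε : ℝ => indepSum M (cs.map fun c e => c e + ε) I := by
  classical
  induction cs generalizing I with
  | nil => exact continuous_const
  | cons c cs ih =>
    simp only [List.map_cons, indepSum_cons]
    exact continuous_finsetSum _ fun e _ => (by fun_prop : Continuous fun ε => c e + ε).mul (ih _)

/-- The Alexandrov-Fenchel inequality for independent sequences of a matroid. -/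
theorem indepSum_mul_le_sq {x y : α → ℝ} {cs : List (α → ℝ)} (hy : ∀ e, 0 ≤ y e)
    (hcs : ∀ c ∈ cs, ∀ e, 0 ≤ c e) (hI : M.Indep I)
    (hr : I.card + cs.length + 2 ≤ matroidRank M) :
    indepSum M (x :: x :: cs) I * indepSum M (y :: y :: cs) I
      ≤ indepSum M (x :: y :: cs) I ^ 2 := by
  have hlim : ∀ ds : List (α → ℝ), Filter.Tendsto
      (fun ε : ℝ => indepSum M (ds.map fun c e => c e + ε) I) (nhdsWithin 0 (Set.Ioi 0))
      (nhds (indepSum M ds I)) := fun ds => by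
    have := (continuous_indepSum_map_add (M := M) ds I).tendsto 0
    simp only [add_zero, List.map_id'] at this
    exact this.mono_left nhdsWithin_le_nhds
  -- All weights are shifted by ε > 0, which makes the fixed ones positive, and then ε tends to 0.
  refine le_of_tendsto_of_tendsto ((hlim (x :: x :: cs)).mul (hlim (y :: y :: cs)))
    ((hlim (x :: y :: cs)).pow 2) ?_
  filter_upwards [self_mem_nhdsWithin] with ε hε
  have hε : 0 < ε := hε
  have hcs' : ∀ c ∈ cs.map (fun c e => c e + ε), ∀ e, 0 < c e := by
    simp only [List.mem_map, forall_exists_index, and_imp, forall_apply_eq_imp_iff₂]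
    exact fun c hc e => by linarith [hcs c hc e]
  refine indepSum_mul_le_sq_of_pos hcs' hI (by simpa using hr) _ _ (indepSum_nonneg ?_ _)
  have hy' : ∀ e, 0 ≤ y e + ε := fun e => by linarith [hy e]
  simp only [List.mem_cons, forall_eq_or_imp]
  exact ⟨hy', hy', fun c hc e => (hcs' c hc e).le⟩

end

/-! ### From weighted sums to counts of bases. -/

open Classical in
/-- The independent sets `A ⊇ I` for which `A \ I` has `a` elements in `R` and `b` elements
outside `R`. -/
noncomputable def indepExtensions {α : Type*} (M : Matroid α) [M.Finite] (R : Set α)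
    (I : Finset α) (a b : ℕ) : Finset (Finset α) :=
  M.ground_finite.toFinset.powerset.filter fun A => M.Indep A ∧ I ⊆ A ∧
    ((A \ I).filter (· ∈ R)).card = a ∧ ((A \ I).filter (· ∉ R)).card = b

section

variable {α : Type*} {M : Matroid α} [M.Finite] {R : Set α} {I A : Finset α} {a b : ℕ}

open Classical in
theorem mem_indepExtensions : A ∈ indepExtensions M R I a b ↔ M.Indep A ∧ I ⊆ A ∧
    ((A \ I).filter (· ∈ R)).card = a ∧ ((A \ I).filter (· ∉ R)).card = b := by
  simp only [indepExtensions, mem_filter, mem_powerset, and_iff_right_iff_imp]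
  intro h e he
  simpa using h.1.subset_ground he

theorem indepExtensions_compl (M : Matroid α) [M.Finite] (R : Set α) (I : Finset α) (a b : ℕ) :
    indepExtensions M Rᶜ I a b = indepExtensions M R I b a := by
  ext A
  rw [mem_indepExtensions, mem_indepExtensions]
  refine and_congr_right' (and_congr_right' (and_comm.trans (and_congr ?_ ?_))) <;>
    exact Eq.congr_left (congrArg card (by ext; simp))

theorem indepExtensions_zero_zero (hI : M.Indep I) : indepExtensions M R I 0 0 = {I} := by
  classical
  ext A
  rw [mem_indepExtensions, mem_singleton]
  constructor
  · rintro ⟨-, h1, h2, h3⟩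
    refine subset_antisymm (fun e he => ?_) h1
    by_contra heI
    simp only [card_eq_zero, filter_eq_empty_iff, mem_sdiff, not_not] at h2 h3
    exact h2 ⟨he, heI⟩ (h3 ⟨he, heI⟩)
  · rintro rfl
    simp [hI]

-- Double counting of pairs (e, A): each A on the right contains a + 1 elements of R outside `I`
-- that can play the role of e.
open Classical in
theorem sum_card_indepExtensions (R : Set α) (I : Finset α) (a b : ℕ) :
    ∑ e ∈ extensions M I with e ∈ R, (indepExtensions M R (insert e I) a b).card
      = (a + 1) * (indepExtensions M R I (a + 1) b).card := by
  simp_rw [card_eq_sum_ones (indepExtensions _ _ _ _ _)]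
  rw [sum_comm' (t' := indepExtensions M R I (a + 1) b)
    (s' := fun A => (A \ I).filter (· ∈ R)), mul_sum]
  · refine sum_congr rfl fun A hA => ?_
    rw [← card_eq_sum_ones, (mem_indepExtensions.mp hA).2.2.1, mul_one]
  intro e A
  have key : e ∈ A → e ∉ I → e ∈ R →
      ((A \ I).filter (· ∈ R)).card = ((A \ insert e I).filter (· ∈ R)).card + 1 ∧
      (A \ I).filter (· ∉ R) = (A \ insert e I).filter (· ∉ R) := by
    intro h1 h2 h3
    rw [sdiff_insert, filter_erase, card_erase_add_one (by simp [h1, h2, h3])]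
    refine ⟨rfl, ?_⟩
    rw [filter_erase, erase_eq_of_notMem (by simp [h3])]
  simp only [mem_filter, mem_extensions, mem_indepExtensions, mem_sdiff]
  constructor
  · rintro ⟨⟨⟨h1, h2⟩, h3⟩, h4, h5, h6, h7⟩
    rw [insert_subset_iff] at h5
    obtain ⟨k1, k2⟩ := key h5.1 h1 h3
    exact ⟨⟨⟨h5.1, h1⟩, h3⟩, h4, h5.2, by rw [k1, h6], by rw [k2, h7]⟩
  · rintro ⟨⟨⟨h1, h2⟩, h3⟩, h4, h5, h6, h7⟩
    obtain ⟨k1, k2⟩ := key h1 h2 h3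
    have hsub : insert e I ⊆ A := insert_subset h1 h5
    refine ⟨⟨⟨h2, h4.subset (by exact_mod_cast hsub)⟩, h3⟩, h4, hsub, by omega, by rw [← k2, h7]⟩

theorem indepSum_indicator_cons (R : Set α) (cs : List (α → ℝ)) (I : Finset α) :
    open Classical in indepSum M (R.indicator 1 :: cs) I
      = ∑ e ∈ extensions M I with e ∈ R, indepSum M cs (insert e I) := by
  classical
  rw [indepSum_cons, sum_filter]
  refine sum_congr (by congr) fun e _ => ?_
  by_cases h : e ∈ R <;> simp [h]

-- Each set arises from a! b! sequences: its elements in R and those outside are ordered separately.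
-- Exchanging R with its complement lets one step serve both inductions.
open Nat in
theorem indepSum_replicate (R : Set α) (hI : M.Indep I) (a b : ℕ) :
    indepSum M (List.replicate a (R.indicator 1) ++ List.replicate b (Rᶜ.indicator 1)) I
      = a ! * b ! * (indepExtensions M R I a b).card := by
  classical
  have step : ∀ (S : Set α) (cs : List (α → ℝ)) (a b : ℕ) (I : Finset α),
      (∀ J : Finset α, M.Indep J →
        indepSum M cs J = a ! * b ! * (indepExtensions M S J a b).card) →
      indepSum M (S.indicator 1 :: cs) I
        = (a + 1)! * b ! * (indepExtensions M S I (a + 1) b).card := by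
    intro S cs a b I h
    rw [indepSum_indicator_cons, sum_congr rfl fun e he =>
      h (insert e I) (indep_insert (mem_filter.mp he).1), ← mul_sum, ← Nat.cast_sum,
      sum_card_indepExtensions, factorial_succ]
    push_cast
    ring
  induction a generalizing I with
  | zero =>
    induction b generalizing I with
    | zero => simp [indepSum_nil, indepExtensions_zero_zero hI]
    | succ b ih =>
      have := step Rᶜ (List.replicate b (Rᶜ.indicator 1)) b 0 I fun J hJ => by
        rw [indepExtensions_compl, mul_comm (b ! : ℝ), ← ih hJ]
        rfl
      rw [indepExtensions_compl, mul_comm ((b + 1)! : ℝ)] at this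
      exact this
  | succ a ih => exact step R _ a b I fun J hJ => ih hJ

theorem numBases_eq_card {r : ℕ} (hrank : matroidRank M = r) (ha : a ≤ r) :
    numBases M R a = (indepExtensions M R ∅ a (r - a)).card := by
  classical
  rw [numBases, ← Set.ncard_coe_finset, ← Set.ncard_image_of_injective _ coe_injective]
  congr 1
  ext A
  simp only [Set.mem_ofPred_eq, Set.mem_image, mem_coe, mem_indepExtensions, empty_subset,
    sdiff_empty, true_and]
  have hinter : ∀ B : Finset α, ((B : Set α) ∩ R).ncard = (B.filter (· ∈ R)).card := fun B => by
    rw [← Set.ncard_coe_finset]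
    congr 1
    ext e
    simp
  constructor
  · rintro ⟨hA, h⟩
    lift A to Finset α using M.ground_finite.subset hA.subset_ground
    have h1 := card_eq_of_isBase hA
    have h2 := card_filter_add_card_filter_not (s := A) (· ∈ R)
    rw [hinter] at h
    exact ⟨A, ⟨hA.indep, h, by omega⟩, rfl⟩
  · rintro ⟨B, ⟨hB, h1, h2⟩, rfl⟩
    refine ⟨?_, by rw [hinter, h1]⟩
    have h3 := card_filter_add_card_filter_not (s := B) (· ∈ R)
    obtain ⟨B', hB', hBB'⟩ := hB.exists_isBase_superset
    lift B' to Finset α using M.ground_finite.subset hB'.subset_ground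
    have h4 := card_eq_of_isBase hB'
    have hBB : B = B' := eq_of_subset_of_card_le (by exact_mod_cast hBB') (by omega)
    rwa [hBB]

open Nat in
theorem factorial_mul_normalizedNumBases {r : ℕ} (hrank : matroidRank M = r) (R : Set α)
    (ha : a ≤ r) : r ! * normalizedNumBases M R a = indepSum M
      (List.replicate a (R.indicator 1) ++ List.replicate (r - a) (Rᶜ.indicator 1)) ∅ := by
  rw [indepSum_replicate R (by simp), normalizedNumBases, hrank, numBases_eq_card hrank ha,
    ← Nat.choose_mul_factorial_mul_factorial ha]
  have : (r.choose a : ℝ) ≠ 0 := by exact_mod_cast (Nat.choose_pos ha).ne'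
  push_cast
  field_simp

/-- The Stanley-Yan inequality. -/
theorem normalizedNumBases_logConcave {r : ℕ} (hrank : matroidRank M = r) (R : Set α)
    (ha : 1 ≤ a) (har : a ≤ r - 1) :
    normalizedNumBases M R (a + 1) * normalizedNumBases M R (a - 1)
      ≤ normalizedNumBases M R a ^ 2 := by
  -- Two slots are kept free: the fixed weights are k = a - 1 indicators of R and m = r - a - 1 of
  -- its complement.
  obtain ⟨k, rfl⟩ : ∃ k, a = k + 1 := ⟨a - 1, by omega⟩
  obtain ⟨m, rfl⟩ : ∃ m, r = k + m + 2 := ⟨r - k - 2, by omega⟩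
  rw [Nat.add_sub_cancel]
  set x : α → ℝ := R.indicator 1
  set y : α → ℝ := Rᶜ.indicator 1
  set cs := List.replicate k x ++ List.replicate m y with hcs
  have hx : ∀ e, 0 ≤ x e := Set.indicator_nonneg fun _ _ => zero_le_one
  have hy : ∀ e, 0 ≤ y e := Set.indicator_nonneg fun _ _ => zero_le_one
  have hf := indepSum_mul_le_sq (M := M) (I := ∅) (x := x) (y := y) (cs := cs) hy
    (by
      intro c hc
      rcases List.mem_append.mp hc with h | h
      · rw [List.eq_of_mem_replicate h]; exact hx
      · rw [List.eq_of_mem_replicate h]; exact hy)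
    (by simp) (by simp [hcs, hrank])
  have h2 := factorial_mul_normalizedNumBases hrank R (a := k + 1 + 1) (by omega)
  have h1 := factorial_mul_normalizedNumBases hrank R (a := k + 1) (by omega)
  have h0 := factorial_mul_normalizedNumBases hrank R (a := k) (by omega)
  rw [show k + m + 2 - (k + 1 + 1) = m by omega] at h2
  rw [show k + m + 2 - (k + 1) = m + 1 by omega, indepSum_perm (ds := x :: y :: cs)
    (by
      rw [List.replicate_succ, List.replicate_succ, List.cons_append]
      exact List.perm_middle.cons x)] at h1
  rw [show k + m + 2 - k = m + 1 + 1 by omega, indepSum_perm (ds := y :: y :: cs)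
    (by
      rw [List.replicate_succ, List.replicate_succ]
      exact List.perm_middle.trans (List.perm_middle.cons y))] at h0
  change _ = indepSum M (x :: x :: cs) ∅ at h2
  rw [← h0, ← h1, ← h2] at hf
  have hfac : (0 : ℝ) < ((k + m + 2).factorial : ℝ) ^ 2 := by positivity
  refine le_of_mul_le_mul_right ?_ hfac
  linarith

theorem normalizedNumBases_pos {r : ℕ} (hrank : matroidRank M = r) {R : Set α}
    (h0 : 0 < normalizedNumBases M R 0) (hr : 0 < normalizedNumBases M R r) (ha : a ≤ r) :
    0 < normalizedNumBases M R a := by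
  classical
  have hcard : ∀ {a}, a ≤ r →
      (0 < normalizedNumBases M R a ↔ (indepExtensions M R ∅ a (r - a)).Nonempty) := by
    intro a ha
    have : (0 : ℝ) < r.choose a := by exact_mod_cast Nat.choose_pos ha
    rw [normalizedNumBases, hrank, numBases_eq_card hrank ha, div_pos_iff_of_pos_right this,
      Nat.cast_pos, card_pos]
  rw [hcard (by omega)] at h0 hr
  rw [hcard ha]
  obtain ⟨B₀, hB₀⟩ := h0
  obtain ⟨B₁, hB₁⟩ := hr
  simp only [mem_indepExtensions, empty_subset, sdiff_empty, true_and, tsub_zero, tsub_self,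
    card_eq_zero, filter_eq_empty_iff, not_not] at hB₀ hB₁
  obtain ⟨i0, i1, i2⟩ := hB₀
  obtain ⟨j0, j1, j2⟩ := hB₁
  have hB₀r : B₀.card = r := by rw [← i2, filter_true_of_mem fun e he => i1 he]
  -- Start from `a` elements of `B₁`, which lies in R, and augment from `B₀`, which avoids R: every
  -- added element is outside R.
  suffices h : ∀ m, a + m ≤ r → (indepExtensions M R ∅ a m).Nonempty from h (r - a) (by omega)
  intro m
  induction m with
  | zero =>
    intro _
    obtain ⟨I, hI, hIa⟩ := exists_subset_card_eq (j1.symm ▸ ha)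
    have hIR : ∀ e ∈ I, e ∈ R := fun e he => (mem_filter.mp (hI he)).2
    refine ⟨I, mem_indepExtensions.mpr ⟨j0.subset ?_, empty_subset _, ?_, ?_⟩⟩
    · exact_mod_cast hI.trans (filter_subset _ _)
    · rw [sdiff_empty, filter_true_of_mem hIR, hIa]
    · rw [sdiff_empty, card_eq_zero, filter_eq_empty_iff]
      exact fun e he => not_not.mpr (hIR e he)
  | succ m ih =>
    intro hm
    obtain ⟨I, hI⟩ := ih (by omega)
    rw [mem_indepExtensions, sdiff_empty] at hI
    obtain ⟨hI, -, k1, k2⟩ := hI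
    have k3 := card_filter_add_card_filter_not (s := I) (· ∈ R)
    obtain ⟨e, he, heI, hind⟩ := hI.augment_finset i0 (by omega)
    refine ⟨insert e I, mem_indepExtensions.mpr ⟨by simpa using hind, empty_subset _, ?_, ?_⟩⟩
    · rw [sdiff_empty, filter_insert, if_neg (i1 he), k1]
    · rw [sdiff_empty, filter_insert, if_pos (i1 he), card_insert_of_notMem (by simp [heI]), k2]

end

theorem corollary1p9 {α : Type*} (M : Matroid α) [M.Finite] (r : ℕ)
    (hrank : matroidRank M = r) (hr : 2 ≤ r) (R : Set α) (hR : R ⊆ M.E)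
    (h0 : 0 < normalizedNumBases M R 0) (hrr : 0 < normalizedNumBases M R r) :
    normalizedNumBases M R 1 ^ r ≥ normalizedNumBases M R 0 ^ (r - 1) * normalizedNumBases M R r ∧
    (normalizedNumBases M R 1 ^ r = normalizedNumBases M R 0 ^ (r - 1) * normalizedNumBases M R r ↔
      ∀ a : ℕ, 1 ≤ a → a ≤ r - 1 →
        normalizedNumBases M R a ^ 2 =
          normalizedNumBases M R (a + 1) * normalizedNumBases M R (a - 1)) :=
  pow_ge_and_eq_iff_of_logConcave hr (fun _ ha => normalizedNumBases_pos hrank h0 hrr ha)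
    fun _ ha har => normalizedNumBases_logConcave hrank R ha har
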